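/- Let $A$ be a central simple algebra of degree $n$ over a field $F$ (so $\dim_F A=n^2$), containing a field $M$ such that $M/F$ is a Galois extension of degree $n$ with non-trivial solvable Galois group $G=\mathrm{Gal}(M/F)$. Let $$\{1\}=G_0\le G_1\le\dots\le G_k=G$$ be a subnormal series ($G_i$ normal in $G_{i+1}$) such that each index $q_i=[G_{i+1}:G_i]$ is prime, and let $$M=A_0\subseteq A_1\subseteq\dots\subseteq A_k=A,\qquad A_i=\mathrm{Cent}_A(\mathrm{Fix}(G_i)),$$ be the corresponding chain of $F$-subalgebras of $A$. Suppose that for every $i\in\{0,\dots,k-1\}$ we are given an $F$-algebra automorphism $\tau_i$ of $A_i$ of inner order $q_i$ (i.e. $q_i$ is the least positive integer $m$ such that $\tau_i^{m}$ has the form $x\mapsto uxu^{-1}$ with $u\in A_i^\times$) which restricts to an element of $G$ on $M$, and an invertible element $c_i\in A_i$ with $\tau_i(c_i)=c_i$, such that the left ideal of $A_i[t_i;\tau_i]$ generated by $t_i^{q_i}-c_i$ is two-sided and $$A_{i+1}\cong A_i[t_i;\tau_i]/A_i[t_i;\tau_i](t_i^{q_i}-c_i)$$ as $F$-algebras. Here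 $A_i[t_i;\tau_i]$ is the twisted polynomial ring with multiplication $t_i a=\tau_i(a)t_i$ for $a\in A_i$. Then $A$ is a division algebra if and only if $$\tau_i^{q_i-1}(b)\cdots\tau_i(b)\,b\neq c_i\qquad\text{for all } b\in A_i \text{ and all } i\in\{0,\dots,k-1\}.$$ -/

import Mathlib

/-- A copy of the ring `S`, on which the monoid `(ℕ, +)` acts through the powers of `σ`, so that
Mathlib's `SkewPolynomial (TwistedCoeff σ)` is the twisted polynomial ring `S[t;σ]`. -/
def TwistedCoeff {F S : Type*} [CommSemiring F] [Ring S] [Algebra F S] (_σ : S ≃ₐ[F] S) : Type _ :=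
  S

namespace TwistedCoeff

variable {F S : Type*} [CommSemiring F] [Ring S] [Algebra F S] (σ : S ≃ₐ[F] S)

instance instRing : Ring (TwistedCoeff σ) := inferInstanceAs (Ring S)

instance instAlgebra : Algebra F (TwistedCoeff σ) := inferInstanceAs (Algebra F S)

/-- An element of `S`, regarded as a coefficient of `S[t;σ]`. -/
def of : S ≃ₐ[F] TwistedCoeff σ := AlgEquiv.refl

instance instAction : MulSemiringAction (Multiplicative ℕ) (TwistedCoeff σ) where
  smul n x := of σ ((σ ^ n.toAdd) ((of σ).symm x))
  one_smul _ := rfl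
  mul_smul m n x := by
    change of σ ((σ ^ (m.toAdd + n.toAdd)) _) = of σ ((σ ^ m.toAdd) ((σ ^ n.toAdd) _))
    rw [pow_add, AlgEquiv.mul_apply]
  smul_zero n := (map_zero (σ ^ n.toAdd) :)
  smul_add n x y := (map_add (σ ^ n.toAdd) (show S from x) (show S from y) :)
  smul_one n := (map_one (σ ^ n.toAdd) :)
  smul_mul n x y := (map_mul (σ ^ n.toAdd) (show S from x) (show S from y) :)

instance instSMulCommClass : SMulCommClass (Multiplicative ℕ) F (TwistedCoeff σ) where
  smul_comm n r x := (map_smul (σ ^ n.toAdd) r (show S from x) :)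

end TwistedCoeff

/-- The twisted polynomial ring `S[t;σ]`, with `t a = σ(a) t`. -/
abbrev TwistedPolynomial {F S : Type*} [CommSemiring F] [Ring S] [Algebra F S] (σ : S ≃ₐ[F] S) :
    Type _ :=
  SkewPolynomial (TwistedCoeff σ)

namespace TwistedPolynomial

variable {F S : Type*} [CommSemiring F] [Ring S] [Algebra F S] (σ : S ≃ₐ[F] S)

/-- The defining relation `t a = σ(a) t` of `S[t;σ]`. -/
theorem X_mul_C (a : S) :
    (SkewPolynomial.X : TwistedPolynomial σ) * SkewPolynomial.C (TwistedCoeff.of σ a) =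
      SkewPolynomial.C (TwistedCoeff.of σ (σ a)) * SkewPolynomial.X := by
  rw [SkewPolynomial.C_mul_X_eq_monomial, SkewPolynomial.X, SkewPolynomial.monomial_mul_C, one_mul]
  rfl

/-- The polynomial `t ^ m - c` in `S[t;σ]`. -/
noncomputable def powSub (m : ℕ) (c : S) : TwistedPolynomial σ :=
  SkewPolynomial.X ^ m - SkewPolynomial.C (TwistedCoeff.of σ c)

end TwistedPolynomial

/-- The left ideal `R f` generated by `f`; `Ideal` means left ideal in Mathlib. -/
abbrev leftIdealOf {R : Type*} [Ring R] (f : R) : Ideal R := Ideal.span {f}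

/-- `f` is right invariant if the left ideal `R f` is two-sided. -/
abbrev IsRightInvariant {R : Type*} [Ring R] (f : R) : Prop := (leftIdealOf f).IsTwoSided

/-- `σ` has inner order `m`: `m` is the least positive integer for which `σ ^ m` is an inner
automorphism `x ↦ u x u⁻¹`. -/
def HasInnerOrder {F S : Type*} [CommSemiring F] [Ring S] [Algebra F S] (σ : S ≃ₐ[F] S) (m : ℕ) :
    Prop :=
  IsLeast {n : ℕ | 0 < n ∧ ∃ u : Sˣ, ∀ x : S, (σ ^ n) x = u * x * ((u⁻¹ : Sˣ) : S)} m

/-- `skewNorm σ m b = σ^{m-1}(b) ⋯ σ(b) b`. -/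
def skewNorm {F S : Type*} [CommSemiring F] [Ring S] [Algebra F S] (σ : S ≃ₐ[F] S) :
    ℕ → S → S
  | 0, _ => 1
  | m + 1, b => (σ ^ m) b * skewNorm σ m b

/-- A ring `A ≠ 0` is a division ring: left and right multiplication by every nonzero element
are bijective. -/
def IsDivisionAlgebra (A : Type*) [Ring A] : Prop :=
  Nontrivial A ∧ ∀ a : A, a ≠ 0 →
    Function.Bijective (fun x => a * x) ∧ Function.Bijective (fun x => x * a)

/-- For a Galois extension `M/F` embedded by `ι` in an `F`-algebra `A`: a chain
`M = A_0 ⊆ A_1 ⊆ ⋯ ⊆ A_k = A` of subalgebras, belonging to a subnormal series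
`1 = G_0 ≤ G_1 ≤ ⋯ ≤ G_k = Gal(M/F)` with factors of prime order `q_i`, together with
`A_{i+1} ≅ A_i[t;τ_i]/A_i[t;τ_i](t ^ q_i - c_i)`. -/
structure CyclicChain {F M A : Type*} [Field F] [Field M] [Algebra F M] [Ring A] [Algebra F A]
    (ι : M →ₐ[F] A) where
  /-- The length of the chain. -/
  k : ℕ
  /-- The subnormal series of `Gal(M/F)`. -/
  G : Fin (k + 1) → Subgroup (M ≃ₐ[F] M)
  G_zero : G 0 = ⊥
  G_last : G (Fin.last k) = ⊤
  G_le : ∀ i : Fin k, G i.castSucc ≤ G i.succ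
  G_normal : ∀ i : Fin k, ((G i.castSucc).subgroupOf (G i.succ)).Normal
  /-- The orders of the factors. -/
  q : Fin k → ℕ
  q_prime : ∀ i, (q i).Prime
  G_index : ∀ i : Fin k, (G i.castSucc).relIndex (G i.succ) = q i
  /-- The subalgebras `A_i`. -/
  alg : Fin (k + 1) → Subalgebra F A
  alg_zero : alg 0 = ι.range
  alg_last : alg (Fin.last k) = ⊤
  /-- `A_i` is the centralizer of `Fix(G_i)` in `A`. -/
  alg_eq : ∀ i, alg i =
    Subalgebra.centralizer F (ι '' (IntermediateField.fixedField (G i) : Set M))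
  /-- The automorphisms `τ_i` of `A_i`. -/
  τ : ∀ i : Fin k, alg i.castSucc ≃ₐ[F] alg i.castSucc
  τ_innerOrder : ∀ i, HasInnerOrder (τ i) (q i)
  /-- `τ_i` restricts to an element of `Gal(M/F)`. -/
  τ_restrict : ∀ i, ∃ σ : M ≃ₐ[F] M, ∀ (x : alg i.castSucc) (m : M),
    (x : A) = ι m → (τ i x : A) = ι (σ m)
  /-- The elements `c_i ∈ Fix(τ_i)ˣ`. -/
  c : ∀ i : Fin k, alg i.castSucc
  c_isUnit : ∀ i, IsUnit (c i)
  c_fixed : ∀ i, τ i (c i) = c i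
  rightInvariant : ∀ i, IsRightInvariant (TwistedPolynomial.powSub (τ i) (q i) (c i))
  iso : ∀ i : Fin k,
    haveI := rightInvariant i
    Nonempty (alg i.succ ≃ₐ[F]
      (TwistedPolynomial (τ i) ⧸ leftIdealOf (TwistedPolynomial.powSub (τ i) (q i) (c i))))

/-! Write D = A_i, B = A_{i+1}, N(b) = σ^{q-1}(b)⋯σ(b)b. The proof compares D and B one step at a
time, using only that B is left free over D on 1, t, …, t^{q-1}. If N(b) = c, then t^q - c = g(t)(t
- b) with g monic of degree q - 1. Both factors are nonzero in B and their product is 0, so the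
larger algebra A is not a division algebra (`skewNorm_ne`). Conversely, climb from the field A_0 =
M. Let D be a division ring. Inner order q makes B simple (`one_mem_of_sum_mem`), and B is Artinian,
so B ≅ S^n as a left module with S simple and q = n · dim_D S. As q is prime, either n = 1 and B is
a division ring, or S = Dy. In the latter case ty = by for some b in D, whence cy = t^q y = N(b)y
and c = N(b). -/

/-- A ring `B` that is generated by the image of `D` and an element `t` with `t a = σ(a) t` and
`t ^ q = c`, and that has the left `D`-basis `1, t, …, t ^ (q - 1)`. -/
structure CyclicPresentation {F D : Type*} [CommSemiring F] [Ring D] [Algebra F D] (σ : D ≃ₐ[F] D)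
    (q : ℕ) (c : D) (B : Type*) [Ring B] where
  /-- The inclusion of the coefficients. -/
  φ : D →+* B
  /-- The generator. -/
  t : B
  t_mul : ∀ a, t * φ a = φ (σ a) * t
  t_pow : t ^ q = φ c
  bijective : Function.Bijective fun a : Fin q → D => ∑ j, φ (a j) * t ^ (j : ℕ)

/-! ### Norms and the linear right factors of t^q - c. -/

namespace CyclicPresentation

variable {F D B : Type*} [CommSemiring F] [Ring D] [Algebra F D] [Ring B] {σ : D ≃ₐ[F] D}
  {q : ℕ} {c : D}

theorem pow_mul (P : CyclicPresentation σ q c B) (n : ℕ) (a : D) :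
    P.t ^ n * P.φ a = P.φ ((σ ^ n) a) * P.t ^ n := by
  induction n generalizing a with
  | zero => simp
  | succ n ih =>
    rw [pow_succ, mul_assoc, P.t_mul, ← mul_assoc, ih, mul_assoc, pow_succ, AlgEquiv.mul_apply]

theorem skewNorm_succ (m : ℕ) (b : D) : skewNorm σ (m + 1) b = (σ ^ m) b * skewNorm σ m b :=
  rfl

/-- The recursion peels off the leftmost factor; moving t past a norm needs the rightmost one. -/
theorem apply_skewNorm_mul (m : ℕ) (b : D) :
    σ (skewNorm σ m b) * b = skewNorm σ (m + 1) b := by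
  induction m with
  | zero => simp [skewNorm]
  | succ m ih =>
    rw [skewNorm_succ, map_mul, mul_assoc, ih, skewNorm_succ (m + 1), pow_succ',
      AlgEquiv.mul_apply]

/-- The left quotient of `t ^ (m + 1) - N_{m+1}(b)` by `t - b` is monic of degree `m`. -/
theorem exists_pow_sub_skewNorm (P : CyclicPresentation σ q c B) (b : D) (m : ℕ) :
    ∃ a : ℕ → D, P.t ^ (m + 1) - P.φ (skewNorm σ (m + 1) b) =
      (P.t ^ m + ∑ j ∈ Finset.range m, P.φ (a j) * P.t ^ j) * (P.t - P.φ b) := by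
  induction m with
  | zero => exact ⟨0, by simp [skewNorm]⟩
  | succ m ih =>
    obtain ⟨a, ha⟩ := ih
    -- The new quotient is t^{m+1} + σ^{m+1}(b) · (old quotient); the 1 at j = m is the leading
    -- coefficient of the old one.
    refine ⟨fun j => (σ ^ (m + 1)) b * (if j = m then 1 else a j), ?_⟩
    have h : P.t ^ (m + 1) * (P.t - P.φ b) + P.φ ((σ ^ (m + 1)) b) *
        (P.t ^ (m + 1) - P.φ (skewNorm σ (m + 1) b)) =
        P.t ^ (m + 1 + 1) - P.φ (skewNorm σ (m + 1 + 1) b) := by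
      rw [mul_sub, mul_sub, P.pow_mul, skewNorm_succ (m + 1), map_mul, ← pow_succ,
        sub_add_sub_cancel]
    rw [← h, ha, ← mul_assoc, ← add_mul, Finset.sum_range_succ, mul_add, Finset.mul_sum]
    congr 2
    rw [add_comm]
    congr 1
    · refine Finset.sum_congr rfl fun j hj => ?_
      dsimp only
      rw [if_neg (Finset.mem_range.1 hj).ne, map_mul, mul_assoc]
    · simp

theorem eq_zero_of_sum_eq_zero (P : CyclicPresentation σ q c B) {a : ℕ → D}
    (h : ∑ j ∈ Finset.range q, P.φ (a j) * P.t ^ j = 0) {j : ℕ} (hj : j < q) : a j = 0 := by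
  have : (fun i : Fin q => a i) = 0 := by
    apply P.bijective.injective
    simp only [Pi.zero_apply, map_zero, zero_mul, Finset.sum_const_zero]
    rwa [Fin.sum_univ_eq_sum_range (fun j => P.φ (a j) * P.t ^ j)]
  exact congrFun this ⟨j, hj⟩

theorem skewNorm_ne [Nontrivial D] [NoZeroDivisors B] (P : CyclicPresentation σ q c B)
    (hq : 2 ≤ q) (b : D) : skewNorm σ q b ≠ c := by
  intro h
  obtain ⟨m, rfl⟩ : ∃ m, q = m + 1 + 1 := ⟨q - 2, by omega⟩
  obtain ⟨a, ha⟩ := P.exists_pow_sub_skewNorm b (m + 1)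
  rw [h, P.t_pow, sub_self, eq_comm, mul_eq_zero] at ha
  rcases ha with ha | ha
  · have := P.eq_zero_of_sum_eq_zero (a := fun j => if j = m + 1 then 1 else a j) ?_
      (Nat.lt_succ_self (m + 1))
    · simp at this
    · rw [Finset.sum_range_succ, ← ha, add_comm, if_pos rfl, map_one, one_mul]
      congr 1
      refine Finset.sum_congr rfl fun j hj => ?_
      rw [if_neg (Finset.mem_range.1 hj).ne]
  -- The other factor t - b is nonzero because 1 < q makes 1 and t independent.
  · have := P.eq_zero_of_sum_eq_zero
      (a := fun j => if j = 0 then -b else if j = 1 then 1 else 0) ?_ (j := 1) (by omega)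
    · simp at this
    · rw [Finset.sum_range_succ', Finset.sum_range_succ']
      simp [add_comm (P.t), ← sub_eq_neg_add, ha]

theorem isUnit_t (P : CyclicPresentation σ q c B) (hq : q ≠ 0) (hc : IsUnit c) : IsUnit P.t := by
  rw [← isUnit_pow_iff hq, P.t_pow]
  exact hc.map P.φ

end CyclicPresentation

/-! ### Simplicity and invertibility over a division ring. -/

/-- If `σ ^ i` and `σ ^ j`, `j ≤ i`, differ by conjugation, then `σ ^ (i - j)` is inner. -/
theorem exists_inner_of_conj {F D : Type*} [CommSemiring F] [DivisionRing D] [Algebra F D]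
    {σ : D ≃ₐ[F] D} {i j : ℕ} (hij : j ≤ i) {a : D} (ha : a ≠ 0)
    (h : ∀ d, a * (σ ^ i) d = (σ ^ j) d * a) :
    ∃ u : Dˣ, ∀ x : D, (σ ^ (i - j)) x = u * x * ((u⁻¹ : Dˣ) : D) := by
  refine ⟨(Units.mk0 a ha)⁻¹, fun x => ?_⟩
  have h1 := h ((σ ^ j).symm x)
  rw [AlgEquiv.apply_symm_apply, ← Nat.sub_add_cancel hij, pow_add, AlgEquiv.mul_apply,
    AlgEquiv.apply_symm_apply] at h1
  rw [inv_inv, mul_assoc, Units.val_mk0, ← h1, Units.val_inv_eq_inv_val, Units.val_mk0,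
    inv_mul_cancel_left₀ ha]

namespace CyclicPresentation

variable {F D B : Type*} [CommSemiring F] [DivisionRing D] [Algebra F D] [Ring B] {σ : D ≃ₐ[F] D}
  {q : ℕ} {c : D}

-- Shortest-element argument: normalise the lowest coefficient to 1, then take twisted commutators
-- with D. Either one of them is nonzero with smaller support, or the element is the unit t^k.
open Finset in
theorem one_mem_of_sum_mem (P : CyclicPresentation σ q c B) (hq : HasInnerOrder σ q) (hc : IsUnit c)
    (J : TwoSidedIdeal B) (a : Fin q → D) (ha : a ≠ 0)
    (haJ : ∑ j, P.φ (a j) * P.t ^ (j : ℕ) ∈ J) : (1 : B) ∈ J := by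
  classical
  induction h : (univ.filter fun j => a j ≠ 0).card using Nat.strong_induction_on
    generalizing a with
  | _ n ih =>
  have hne : (univ.filter fun j => a j ≠ 0).Nonempty := by
    obtain ⟨j, hj⟩ := Function.ne_iff.1 ha
    exact ⟨j, by simpa using hj⟩
  obtain ⟨k, hk, hmin⟩ := exists_min_image _ (fun j : Fin q => (j : ℕ)) hne
  replace hk : a k ≠ 0 := by simpa using hk
  set a' : Fin q → D := fun j => (a k)⁻¹ * a j
  have ha'k : a' k = 1 := inv_mul_cancel₀ hk
  have ha' : ∀ j, a' j ≠ 0 ↔ a j ≠ 0 := by simp [a', hk]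
  have ha'J : ∑ j, P.φ (a' j) * P.t ^ (j : ℕ) ∈ J := by
    have := J.mul_mem_left (P.φ (a k)⁻¹) _ haJ
    simpa only [mul_sum, ← mul_assoc, ← map_mul] using this
  clear_value a'
  by_cases hall : ∀ j d, a' j * (σ ^ (j : ℕ)) d = (σ ^ (k : ℕ)) d * a' j
  · have hz : ∀ j, j ≠ k → a' j = 0 := by
      intro j hjk
      by_contra hj
      have hkj : (k : ℕ) ≤ j := hmin j (by simpa using (ha' j).1 hj)
      have hlt : (k : ℕ) < j := lt_of_le_of_ne hkj fun e => hjk (Fin.ext e.symm)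
      -- A second exponent j would make σ^{j-k} inner with 0 < j - k < q.
      have := hq.2 ⟨Nat.sub_pos_of_lt hlt, exists_inner_of_conj hkj hj (hall j)⟩
      have := j.isLt
      omega
    rw [sum_eq_single k (fun j _ hj => by rw [hz j hj, map_zero, zero_mul]) (by simp), ha'k,
      map_one, one_mul] at ha'J
    obtain ⟨u, hu⟩ := (P.isUnit_t hq.1.1.ne' hc).pow (k : ℕ)
    rw [← hu] at ha'J
    simpa using J.mul_mem_left (↑u⁻¹ : B) _ ha'J
  · push Not at hall
    obtain ⟨j, d, hj⟩ := hall
    refine ih _ ?_ (fun j => a' j * (σ ^ (j : ℕ)) d - (σ ^ (k : ℕ)) d * a' j)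
      (fun e => hj (sub_eq_zero.1 (congrFun e j))) ?_ rfl
    · rw [← h]
      refine card_lt_card ⟨fun i hi => ?_, fun hs => ?_⟩
      · simp only [mem_filter, mem_univ, true_and] at hi ⊢
        rw [← ha']
        intro h0
        simp [h0] at hi
      -- The commutator loses its t^k term, since a'_k = 1.
      · have := hs (show k ∈ _ by simpa using hk)
        simp [ha'k] at this
    · have := J.sub_mem (J.mul_mem_right _ (P.φ d) ha'J)
        (J.mul_mem_left (P.φ ((σ ^ (k : ℕ)) d)) _ ha'J)
      rw [sum_mul, mul_sum, ← sum_sub_distrib] at this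
      convert this using 2 with i
      rw [map_sub, map_mul, map_mul, sub_mul, mul_assoc, mul_assoc, mul_assoc, P.pow_mul]

theorem nontrivial (P : CyclicPresentation σ q c B) (hq : 0 < q) : Nontrivial B := by
  have : Nonempty (Fin q) := ⟨⟨0, hq⟩⟩
  exact P.bijective.injective.nontrivial

theorem isSimpleRing (P : CyclicPresentation σ q c B) (hq : HasInnerOrder σ q) (hc : IsUnit c) :
    IsSimpleRing B := by
  have := P.nontrivial hq.1.1
  refine ⟨⟨fun J => or_iff_not_imp_left.2 fun hJ => ?_⟩⟩
  obtain ⟨x, hx, hx0⟩ : ∃ x ∈ J, x ≠ 0 := by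
    by_contra! h
    exact hJ (eq_bot_iff.2 fun x hx => (TwoSidedIdeal.mem_bot B).2 (h x hx))
  obtain ⟨a, rfl⟩ := P.bijective.surjective x
  have h1 := P.one_mem_of_sum_mem hq hc J a (by rintro rfl; simp at hx0) hx
  exact eq_top_iff.2 fun y _ => by simpa using J.mul_mem_left y _ h1

theorem skewNorm_mul_eq (P : CyclicPresentation σ q c B) {b : D} {x : B} (h : P.t * x = P.φ b * x)
    (m : ℕ) : P.t ^ m * x = P.φ (skewNorm σ m b) * x := by
  induction m with
  | zero => simp [skewNorm]
  | succ m ih =>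
    rw [pow_succ', mul_assoc, ih, ← mul_assoc, P.t_mul, mul_assoc, h, ← apply_skewNorm_mul, map_mul,
      mul_assoc]

theorem isUnit_of_ne_zero (P : CyclicPresentation σ q c B) (hq : HasInnerOrder σ q)
    (hqp : q.Prime) (hc : IsUnit c) (hN : ∀ b, skewNorm σ q b ≠ c) (x : B) (hx : x ≠ 0) :
    IsUnit x := by
  have := P.nontrivial hq.1.1
  have := P.isSimpleRing hq hc
  let _ : Module D B := Module.compHom B P.φ
  have smul_def : ∀ (d : D) (y : B), d • y = P.φ d * y := fun _ _ => rfl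
  have : IsScalarTower D B B := ⟨fun d y z => mul_assoc (P.φ d) y z⟩
  let e : (Fin q → D) ≃ₗ[D] B := LinearEquiv.ofBijective
    { toFun := fun a => ∑ j : Fin q, P.φ (a j) * P.t ^ (j : ℕ)
      map_add' := fun a b => by simp [add_mul, Finset.sum_add_distrib]
      map_smul' := fun d a => by simp [smul_def, Finset.mul_sum, mul_assoc] } P.bijective
  have : Module.Finite D B := Module.Finite.equiv e
  have hrank : Module.finrank D B = q := by rw [← e.finrank_eq, Module.finrank_fin_fun]
  have : IsArtinianRing B := isArtinian_of_tower D inferInstance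
  -- Wedderburn decomposition B ≅ S^n; counting dimensions over D gives q = n · dim_D S.
  obtain ⟨n, hn, S, hS, ⟨f⟩⟩ := (IsSimpleRing.isIsotypic B B).linearEquiv_fun
  have : IsScalarTower D B S := ⟨fun d y z => Subtype.ext (mul_assoc (P.φ d) y (z : B))⟩
  have : Module.Finite D S := Module.Finite.of_injective (S.subtype.restrictScalars D)
    Subtype.val_injective
  have hrank' : q = n * Module.finrank D S := by
    rw [← hrank, (f.restrictScalars D).finrank_eq, Module.finrank_pi_fintype]
    simp
  rcases (Nat.prime_mul_iff.1 (hrank' ▸ hqp)) with ⟨-, h1⟩ | ⟨-, h1⟩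
  · exfalso
    obtain ⟨y, hy, hspan⟩ := finrank_eq_one_iff'.1 h1
    obtain ⟨b, hb⟩ := hspan (P.t • y)
    have hb' : P.t * (y : B) = P.φ b * y := (congrArg Subtype.val hb).symm
    have hq' := P.skewNorm_mul_eq hb' q
    rw [P.t_pow, ← sub_eq_zero, ← sub_mul, ← map_sub] at hq'
    have h0 : (c - skewNorm σ q b) • y = 0 := Subtype.ext hq'
    rcases smul_eq_zero.1 h0 with h0 | h0
    · exact hN b (sub_eq_zero.1 h0).symm
    · exact hy h0
  · subst h1
    have : IsSimpleModule B B := IsSimpleModule.congr (f.trans (LinearEquiv.funUnique (Fin 1) B S))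
    exact (isSimpleModule_self_iff_isUnit.1 this).2 x hx

end CyclicPresentation

/-! ### Division with remainder by t^q - c. -/

namespace TwistedPolynomial

variable {F D : Type*} [CommSemiring F] [Ring D] [Algebra F D] (σ : D ≃ₐ[F] D)

theorem coeff_mul_powSub (p : TwistedPolynomial σ) (q : ℕ) (c : D) (m : ℕ) :
    SkewPolynomial.coeff (p * powSub σ q c) (m + q) = SkewPolynomial.coeff p m -
      SkewPolynomial.coeff p (m + q) * TwistedCoeff.of σ ((σ ^ (m + q)) c) := by
  have h1 : SkewPolynomial.coeff (p * SkewPolynomial.X ^ q) (m + q) =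
      SkewPolynomial.coeff p m := by
    rw [← SkewPolynomial.monomial_one_right_eq_X_pow]
    refine (SkewMonoidAlgebra.coeff_mul_single_aux p (y := Multiplicative.ofAdd m) fun a => ?_).trans
      (by rw [smul_one, mul_one]; rfl)
    rw [ofAdd_add, mul_left_inj]
  have h2 : SkewPolynomial.coeff (p * SkewPolynomial.C (TwistedCoeff.of σ c)) (m + q) =
      SkewPolynomial.coeff p (m + q) * TwistedCoeff.of σ ((σ ^ (m + q)) c) :=
    SkewMonoidAlgebra.coeff_mul_single_one p _ _
  rw [powSub, mul_sub, ← h1, ← h2, SkewPolynomial.coeff,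
    SkewMonoidAlgebra.coeff_sub]
  rfl

/-- As t^q - c is monic, a nonzero left multiple g(t^q - c) has degree deg g + q; this gives
uniqueness of remainders. -/
theorem eq_zero_of_mem_leftIdealOf {q : ℕ} (hq : 0 < q) {c : D} {p : TwistedPolynomial σ}
    (hp : p ∈ leftIdealOf (powSub σ q c)) (h : ∀ m, q ≤ m → SkewPolynomial.coeff p m = 0) :
    p = 0 := by
  obtain ⟨g, rfl⟩ := Ideal.mem_span_singleton'.1 hp
  suffices g = 0 by rw [this, zero_mul]
  by_contra hg
  have hs : (SkewPolynomial.support g).Nonempty :=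
    Finset.nonempty_iff_ne_empty.2 (mt SkewPolynomial.support_eq_empty.1 hg)
  have hN := (SkewPolynomial.support g).max'_mem hs
  set N := (SkewPolynomial.support g).max' hs
  have hz : SkewPolynomial.coeff g (N + q) = 0 := by
    by_contra h0
    have := (SkewPolynomial.support g).le_max' _ (SkewPolynomial.mem_support_iff.2 h0)
    omega
  have := h (N + q) (Nat.le_add_left _ _)
  rw [coeff_mul_powSub, hz, zero_mul, sub_zero] at this
  exact SkewPolynomial.mem_support_iff.1 hN this

/-- The generator and the coefficients of `S[t;σ]/S[t;σ](t ^ q - c)`. -/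
noncomputable def cyclicPresentation {q : ℕ} (hq : 0 < q) (c : D)
    [IsRightInvariant (powSub σ q c)] :
    CyclicPresentation σ q c (TwistedPolynomial σ ⧸ leftIdealOf (powSub σ q c)) where
  φ := (Ideal.Quotient.mk _).comp
    (SkewPolynomial.CRingHom.comp (TwistedCoeff.of σ : D →+* TwistedCoeff σ))
  t := Ideal.Quotient.mk _ SkewPolynomial.X
  t_mul a := by
    have := congrArg (Ideal.Quotient.mk (leftIdealOf (powSub σ q c))) (X_mul_C σ a)
    rwa [map_mul, map_mul] at this
  t_pow := by
    rw [← map_pow]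
    exact Ideal.Quotient.eq.2 (Ideal.mem_span_singleton_self _)
  bijective := by
    set π := Ideal.Quotient.mk (leftIdealOf (powSub σ q c))
    have key : ∀ (a : D) (n : ℕ), π (SkewPolynomial.C (TwistedCoeff.of σ a)) *
        π SkewPolynomial.X ^ n = π (SkewPolynomial.monomial n (TwistedCoeff.of σ a)) := fun a n => by
      rw [← map_pow, ← map_mul, SkewPolynomial.C_mul_X_pow_eq_monomial]
    have hsum : ∀ a : Fin q → D, ∑ j, (π.comp (SkewPolynomial.CRingHom.comp
        (TwistedCoeff.of σ : D →+* TwistedCoeff σ))) (a j) * π SkewPolynomial.X ^ (j : ℕ) =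
        π (∑ j : Fin q, SkewPolynomial.monomial (j : ℕ) (TwistedCoeff.of σ (a j))) := fun a => by
      rw [map_sum]
      exact Finset.sum_congr rfl fun j _ => key _ _
    simp only [hsum]
    have coeff_sum : ∀ (a : Fin q → D) (m : ℕ), SkewPolynomial.coeff
        (∑ j : Fin q, SkewPolynomial.monomial (j : ℕ) (TwistedCoeff.of σ (a j))) m =
        ∑ j : Fin q, if (j : ℕ) = m then TwistedCoeff.of σ (a j) else 0 := fun a m => by
      rw [← Finset.sum_congr rfl fun j _ => SkewPolynomial.coeff_monomial]
      exact map_sum (⟨⟨fun p => SkewPolynomial.coeff p m, rfl⟩, fun x y => by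
        dsimp only [SkewPolynomial.coeff]; rw [SkewMonoidAlgebra.coeff_add]; rfl⟩ :
        TwistedPolynomial σ →+ TwistedCoeff σ) _ _
    constructor
    · intro a b hab
      rw [← sub_eq_zero, ← map_sub, ← Finset.sum_sub_distrib] at hab
      simp only [← map_sub] at hab
      have h0 := eq_zero_of_mem_leftIdealOf σ hq (Ideal.Quotient.eq_zero_iff_mem.1 hab)
        fun m hm => by
          rw [coeff_sum (fun j => a j - b j)]
          exact Finset.sum_eq_zero fun j _ => if_neg (by omega)
      funext j
      have hj := coeff_sum (fun j => a j - b j) j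
      simp only [Fin.val_inj, Finset.sum_ite_eq', Finset.mem_univ, if_true] at hj
      rw [h0, SkewPolynomial.coeff_zero, eq_comm, map_eq_zero_iff _ (TwistedCoeff.of σ).injective,
        sub_eq_zero] at hj
      exact hj
    · have mono : ∀ (n : ℕ) (r : D), ∃ a : Fin q → D, π (∑ j : Fin q, SkewPolynomial.monomial (j : ℕ)
          (TwistedCoeff.of σ (a j))) = π (SkewPolynomial.monomial n (TwistedCoeff.of σ r)) := by
        intro n
        induction n using Nat.strong_induction_on with
        | _ n ih =>
        intro r
        by_cases hn : n < q
        · refine ⟨Pi.single ⟨n, hn⟩ r, ?_⟩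
          rw [Finset.sum_eq_single ⟨n, hn⟩ (fun j _ hj => by
            rw [Pi.single_eq_of_ne hj, map_zero, map_zero]) (by simp), Pi.single_eq_same]
        -- Modulo the ideal, r t^n = r t^q t^{n-q} = (rc) t^{n-q}; splitting t^q off on the left
        -- avoids a twist of c.
        · obtain ⟨a, ha⟩ := ih (n - q) (by omega) (r * c)
          refine ⟨a, ha.trans ?_⟩
          have hX : π SkewPolynomial.X ^ q = π (SkewPolynomial.C (TwistedCoeff.of σ c)) := by
            rw [← map_pow]
            exact Ideal.Quotient.eq.2 (Ideal.mem_span_singleton_self _)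
          rw [← key, ← key, map_mul, SkewPolynomial.C_mul, map_mul, ← hX, mul_assoc, ← pow_add,
            Nat.add_sub_cancel' (not_lt.1 hn)]
      intro x
      obtain ⟨p, rfl⟩ := Ideal.Quotient.mk_surjective x
      induction p using SkewPolynomial.induction with
      | h0 => exact ⟨0, by simp⟩
      | ha n r p _ _ ih =>
        obtain ⟨a, ha⟩ := ih
        obtain ⟨b, hb⟩ := mono n ((TwistedCoeff.of σ).symm r)
        refine ⟨b + a, ?_⟩
        rw [AlgEquiv.apply_symm_apply] at hb
        simp only at ha
        rw [map_add π, ← hb, ← ha, ← map_add π, ← Finset.sum_add_distrib]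
        simp only [Pi.add_apply, map_add]

end TwistedPolynomial

/-! ### Passage along the chain. -/

theorem isDivisionAlgebra_iff_isUnit {A : Type*} [Ring A] :
    IsDivisionAlgebra A ↔ Nontrivial A ∧ ∀ a : A, a ≠ 0 → IsUnit a := by
  refine and_congr_right fun _ => forall₂_congr fun a ha => ⟨fun h => ?_, fun h => ?_⟩
  · obtain ⟨x, hx⟩ := h.1.surjective 1
    obtain ⟨y, hy⟩ := h.2.surjective 1
    exact isUnit_iff_exists.2 ⟨x, hx, by rwa [← left_inv_eq_right_inv hy hx]⟩
  · exact ⟨h.unit.mulLeft_bijective, h.unit.mulRight_bijective⟩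

/-- A quotient `D[t;σ]/D[t;σ](t ^ q - c)` of prime degree `q`, where `σ` has inner order `q`, is a
division ring if `c` is not a norm. -/
theorem TwistedPolynomial.isUnit_quotient {F D : Type*} [CommSemiring F] [Ring D] [Algebra F D]
    [Nontrivial D] (hD : ∀ a : D, a ≠ 0 → IsUnit a) {σ : D ≃ₐ[F] D} {q : ℕ} (hq : HasInnerOrder σ q)
    (hqp : q.Prime) {c : D} (hc : IsUnit c) (hN : ∀ b, skewNorm σ q b ≠ c)
    [IsRightInvariant (powSub σ q c)]
    (x : TwistedPolynomial σ ⧸ leftIdealOf (powSub σ q c)) (hx : x ≠ 0) : IsUnit x := by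
  let P := cyclicPresentation σ hqp.pos c
  let _ : DivisionRing D := .ofIsUnitOrEqZero fun a => (or_iff_not_imp_right.2 (hD a))
  exact P.isUnit_of_ne_zero hq hqp hc hN x hx

theorem mainTheorem11 {F M A : Type*} [Field F] [Field M] [Algebra F M] [Ring A] [Algebra F A]
    [FiniteDimensional F A] [Algebra.IsCentral F A] [IsSimpleRing A]
    [FiniteDimensional F M] [IsGalois F M]
    (n : ℕ) (hA : Module.finrank F A = n ^ 2) (hM : Module.finrank F M = n)
    (hsolv : Group.IsSolvable (M ≃ₐ[F] M)) (hnontriv : Nontrivial (M ≃ₐ[F] M))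
    (ι : M →ₐ[F] A) (S : CyclicChain ι) :
    IsDivisionAlgebra A ↔
      ∀ (i : Fin S.k) (b : S.alg i.castSucc), skewNorm (S.τ i) (S.q i) b ≠ S.c i := by
  rw [isDivisionAlgebra_iff_isUnit]
  constructor
  · rintro ⟨_, hdiv⟩ i b
    have := S.rightInvariant i
    have : NoZeroDivisors A := ⟨fun {a b} hab => or_iff_not_imp_left.2 fun ha =>
      (hdiv a ha).mul_right_eq_zero.1 hab⟩
    obtain ⟨e⟩ := S.iso i
    -- The quotient embeds in A through A_{i+1}, so it inherits the absence of zero divisors.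
    have := e.symm.injective.noZeroDivisors e.symm (map_zero _) (map_mul _)
    exact (TwistedPolynomial.cyclicPresentation (S.τ i) (S.q_prime i).pos (S.c i)).skewNorm_ne
      (S.q_prime i).two_le b
  · intro hN
    refine ⟨inferInstance, ?_⟩
    have key : ∀ i, ∀ x : S.alg i, x ≠ 0 → IsUnit x := by
      intro i
      induction i using Fin.induction with
      | zero =>
        rw [S.alg_zero]
        intro x hx
        obtain ⟨m, hm⟩ := ι.rangeRestrict_surjective x
        have hm0 : m ≠ 0 := by rintro rfl; exact hx (by rw [← hm, map_zero])
        exact hm ▸ hm0.isUnit.map ι.rangeRestrict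
      | succ i ih =>
        intro x hx
        have := S.rightInvariant i
        obtain ⟨e⟩ := S.iso i
        have := TwistedPolynomial.isUnit_quotient ih (S.τ_innerOrder i) (S.q_prime i)
          (S.c_isUnit i) (hN i) (e x) (by simpa using hx)
        simpa using this.map e.symm
    intro a ha
    have := key (Fin.last S.k) ⟨a, by rw [S.alg_last]; trivial⟩ fun h => ha (congrArg Subtype.val h)
    exact this.map (S.alg (Fin.last S.k)).val
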